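/- Let $\{0,1\}^*$ be the monoid of finite words over the alphabet $\{0,1\}$, including the empty word. Let $\mu_q:\{0,1\}^*\to\mathrm{GL}_2(\mathbb{Z}[q^{\pm1}])$ be the morphism of monoids given on the letters by \[ \mu_q(0)=R_q^2S_qR_q=\begin{pmatrix} q+q^2 & 1\\ q & 1\end{pmatrix},\qquad \mu_q(1)=R_q^3S_qR_q^2S_qR_q=\begin{pmatrix} q+2q^2+q^3+q^4 & 1+q\\ q+q^2 & 1\end{pmatrix}, \] where $R_q=\begin{pmatrix} q&1\\0&1\end{pmatrix}$ and $S_q=\begin{pmatrix}0&-q^{-1}\\1&0\end{pmatrix}$. Let $M_{12}$ denote the upper right entry of a $2\times2$ matrix $M$. For a biinfinite sequence $s\in\{0,1\}^{\mathbb{Z}}$ let $\mathcal{L}(s)=\{s_ks_{k+1}\cdots s_{k+n-1}\mid k\in\mathbb{Z},\ n\ge 0\}$ be its language, the set of its finite factors. The sequence $s$ is called balanced if, for every $n\ge1$, all $u,v\in\mathcal{L}(s)$ of length $n$ and every letter $a\in\{0,1\}$, the numbers of occurrences of $a$ in $u$ and in $v$ differ by at most $1$. Corollary. Let $s\in\{0,1\}^{\mathbb{Z}}$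 be a balanced sequence. Then the map $u\mapsto\mu_q(u)_{12}$ is injective on $\mathcal{L}(s)$. -/

import Mathlib

open scoped LaurentPolynomial MatrixGroups

namespace QMarkoff

/-- The language of a biinfinite sequence `s`: the set of finite words
`s_k s_{k+1} ⋯ s_{k+n-1}` with `k ∈ ℤ` and `n ≥ 0` (the empty word included). -/
def language {α : Type*} (s : ℤ → α) : Set (FreeMonoid α) :=
  {w | ∃ (k : ℤ) (n : ℕ), w = FreeMonoid.ofList (List.ofFn fun i : Fin n => s (k + (i : ℕ)))}

/-- A biinfinite sequence is balanced if, for every positive `n`, every two factors `u`, `v`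
of length `n` and every letter `a`, the numbers of occurrences of `a` in `u` and in `v`
differ by at most `1`. -/
def IsBalanced {α : Type*} [DecidableEq α] (s : ℤ → α) : Prop :=
  ∀ n : ℕ, 0 < n → ∀ u ∈ language s, ∀ v ∈ language s,
    (FreeMonoid.toList u).length = n → (FreeMonoid.toList v).length = n →
      ∀ a : α, |((FreeMonoid.toList u).count a : ℤ) - ((FreeMonoid.toList v).count a : ℤ)| ≤ 1

noncomputable section

/-- The indeterminate `q` of the ring `ℤ[q, q⁻¹]` of Laurent polynomials. -/
def q : ℤ[T;T⁻¹] := LaurentPolynomial.T 1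

/-- The inverse `q⁻¹` of the indeterminate. -/
def qInv : ℤ[T;T⁻¹] := LaurentPolynomial.T (-1)

theorem q_mul_qInv : q * qInv = 1 := by
  rw [q, qInv, ← LaurentPolynomial.T_add]
  simp

theorem qInv_mul_q : qInv * q = 1 := by
  rw [mul_comm, q_mul_qInv]

/-- The `q`-deformation `R_q` of the matrix `R = (1 1; 0 1)`. -/
def Rq : GL (Fin 2) ℤ[T;T⁻¹] where
  val := !![q, 1; 0, 1]
  inv := !![qInv, -qInv; 0, 1]
  val_inv := by simp [Matrix.one_fin_two, q_mul_qInv]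
  inv_val := by simp [Matrix.one_fin_two, qInv_mul_q]

/-- The `q`-deformation `S_q` of the matrix `S = (0 -1; 1 0)`. -/
def Sq : GL (Fin 2) ℤ[T;T⁻¹] where
  val := !![0, -qInv; 1, 0]
  inv := !![0, 1; -q, 0]
  val_inv := by simp [Matrix.one_fin_two, qInv_mul_q]
  inv_val := by simp [Matrix.one_fin_two, q_mul_qInv]

/-- The morphism of monoids `μ_q : {0, 1}* → GL₂(ℤ[q, q⁻¹])` given on the two letters by
`μ_q(0) = R_q² S_q R_q` and `μ_q(1) = R_q³ S_q R_q² S_q R_q`. -/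
def muq : FreeMonoid (Fin 2) →* GL (Fin 2) ℤ[T;T⁻¹] :=
  FreeMonoid.lift ![Rq ^ 2 * Sq * Rq, Rq ^ 3 * Sq * Rq ^ 2 * Sq * Rq]

theorem coe_Rq_sq_mul_Sq : ((Rq ^ 2 * Sq : GL (Fin 2) ℤ[T;T⁻¹]) : Matrix (Fin 2) (Fin 2) ℤ[T;T⁻¹]) =
    !![q + 1, -q; 1, 0] := by
  have h := q_mul_qInv
  simp only [Units.val_mul, Rq, Sq, pow_two, Matrix.mul_fin_two]
  refine Matrix.ext fun i j => ?_
  fin_cases i <;> fin_cases j <;> simp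
  rw [mul_assoc, h, mul_one]

theorem muq_zero : (muq (FreeMonoid.of 0) : Matrix (Fin 2) (Fin 2) ℤ[T;T⁻¹]) =
    !![q + q ^ 2, 1; q, 1] := by
  simp only [muq, FreeMonoid.lift_eval_of, Matrix.cons_val_zero]
  rw [Units.val_mul, coe_Rq_sq_mul_Sq]
  simp only [Rq, Matrix.mul_fin_two]
  refine Matrix.ext fun i j => ?_
  fin_cases i <;> fin_cases j <;> simp <;> ring

theorem muq_one : (muq (FreeMonoid.of 1) : Matrix (Fin 2) (Fin 2) ℤ[T;T⁻¹]) =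
    !![q + 2 * q ^ 2 + q ^ 3 + q ^ 4, 1 + q; q + q ^ 2, 1] := by
  have h : Rq ^ 3 * Sq * Rq ^ 2 * Sq * Rq = Rq * (Rq ^ 2 * Sq) * (Rq ^ 2 * Sq) * Rq := by group
  simp only [muq, FreeMonoid.lift_eval_of, Matrix.cons_val_one, Matrix.cons_val_zero]
  rw [h, Units.val_mul, Units.val_mul, Units.val_mul, coe_Rq_sq_mul_Sq]
  simp only [Rq, Matrix.mul_fin_two]
  refine Matrix.ext fun i j => ?_
  fin_cases i <;> fin_cases j <;> simp <;> ring

end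

end QMarkoff

/-! Injectivity already holds at `q = 1`, where the letters become the symmetric matrices (2 1; 1 1)
and (5 2; 2 1) of determinant 1. A word is encoded by its height function, which counts the letters
1 in its prefixes. Up to any given length, the factors of a balanced sequence stay close to lines of
one irrational slope α (`IsBalanced.exists_slope`).

For equal lengths, balance makes two height functions pointwise comparable, and one climbs from the
lower to the upper by raising single points without leaving this class (`exists_raise`). Each move
turns a factor 01 into 10, or a final 0 into 1, and increases the upper right entry (`raise_lt`).

For lengths n and n + 1 with n ≥ 1, the shorter word lies below the ceiling word 1x of slope α and
the longer one above the floor word 0xe. Irrationality makes x the same in both, and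
`wordMat_one_cons_lt` compares them. -/

namespace QMarkoff

/-! ### Matrix inequalities at q = 1 -/

/-- The value at `q = 1` of the matrices of the letters, as a function of the letter. -/
def letterMat (e : ℤ) : Matrix (Fin 2) (Fin 2) ℤ := !![2 + 3 * e, 1 + e; 1 + e, 1]

/-- The product of the letter matrices along a word. -/
def wordMat (l : List ℤ) : Matrix (Fin 2) (Fin 2) ℤ := (l.map letterMat).prod

/-- All letters of the word are `0` or `1`. -/
def Binary (l : List ℤ) : Prop := ∀ e ∈ l, e = 0 ∨ e = 1

theorem binary_append {l m : List ℤ} : Binary (l ++ m) ↔ Binary l ∧ Binary m := by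
  simp only [Binary, List.mem_append]
  exact ⟨fun h => ⟨fun e he => h e (Or.inl he), fun e he => h e (Or.inr he)⟩,
    fun h e he => he.elim (h.1 e) (h.2 e)⟩

theorem binary_cons {a : ℤ} {l : List ℤ} : Binary (a :: l) ↔ (a = 0 ∨ a = 1) ∧ Binary l := by
  simp [Binary]

theorem wordMat_nil : wordMat [] = 1 := by simp [wordMat]

theorem wordMat_append (l m : List ℤ) : wordMat (l ++ m) = wordMat l * wordMat m := by
  simp [wordMat]

theorem wordMat_cons (a : ℤ) (l : List ℤ) : wordMat (a :: l) = letterMat a * wordMat l := by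
  simp [wordMat]

theorem wordMat_concat (l : List ℤ) (a : ℤ) : wordMat (l ++ [a]) = wordMat l * letterMat a := by
  simp [wordMat]

theorem letterMat_transpose (e : ℤ) : (letterMat e).transpose = letterMat e := by
  ext i j
  fin_cases i <;> fin_cases j <;> simp [letterMat]

theorem wordMat_reverse (l : List ℤ) : wordMat l.reverse = (wordMat l).transpose := by
  induction l with
  | nil => simp [wordMat_nil]
  | cons a l ih =>
    rw [List.reverse_cons, wordMat_concat, ih, wordMat_cons, Matrix.transpose_mul,
      letterMat_transpose]

theorem wordMat_cons_entries (a : ℤ) (l : List ℤ) :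
    wordMat (a :: l) 0 0 = (2 + 3 * a) * wordMat l 0 0 + (1 + a) * wordMat l 1 0 ∧
    wordMat (a :: l) 0 1 = (2 + 3 * a) * wordMat l 0 1 + (1 + a) * wordMat l 1 1 ∧
    wordMat (a :: l) 1 0 = (1 + a) * wordMat l 0 0 + wordMat l 1 0 ∧
    wordMat (a :: l) 1 1 = (1 + a) * wordMat l 0 1 + wordMat l 1 1 := by
  simp [wordMat_cons, letterMat, Matrix.mul_apply, Fin.sum_univ_two]

theorem wordMat_concat_entries (l : List ℤ) (a : ℤ) :
    wordMat (l ++ [a]) 0 0 = wordMat l 0 0 * (2 + 3 * a) + wordMat l 0 1 * (1 + a) ∧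
    wordMat (l ++ [a]) 0 1 = wordMat l 0 0 * (1 + a) + wordMat l 0 1 ∧
    wordMat (l ++ [a]) 1 0 = wordMat l 1 0 * (2 + 3 * a) + wordMat l 1 1 * (1 + a) ∧
    wordMat (l ++ [a]) 1 1 = wordMat l 1 0 * (1 + a) + wordMat l 1 1 := by
  simp [wordMat_concat, letterMat, Matrix.mul_apply, Fin.sum_univ_two]

theorem wordMat_pos {l : List ℤ} (hl : Binary l) :
    0 < wordMat l 0 0 ∧ 0 ≤ wordMat l 0 1 ∧ 0 ≤ wordMat l 1 0 ∧ 0 < wordMat l 1 1 := by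
  induction l with
  | nil => simp [wordMat_nil]
  | cons a l ih =>
    obtain ⟨ha, hl⟩ := binary_cons.1 hl
    obtain ⟨h1, h2, h3, h4⟩ := ih hl
    obtain ⟨e1, e2, e3, e4⟩ := wordMat_cons_entries a l
    rw [e1, e2, e3, e4]
    rcases ha with rfl | rfl <;> refine ⟨?_, ?_, ?_, ?_⟩ <;> linarith

theorem wordMat_upper_lt {l : List ℤ} (hl : Binary l) : wordMat l 0 1 < wordMat l 0 0 := by
  induction l using List.reverseRecOn with
  | nil => simp [wordMat_nil]
  | append_singleton l a ih =>
    obtain ⟨hl, ha⟩ := binary_append.1 hl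
    obtain ⟨e1, e2, e3, e4⟩ := wordMat_concat_entries l a
    have := ih hl
    obtain ⟨h1, h2, h3, h4⟩ := wordMat_pos hl
    rw [e1, e2]
    rcases ha a (by simp) with rfl | rfl <;> linarith

/-- In the entries of x, this is the inequality between the words 1x and 0x0 needed in
`wordMat_one_cons_lt`. -/
theorem wordMat_row_ineq {l : List ℤ} (hl : Binary l) :
    3 * wordMat l 0 1 + wordMat l 1 1 < 2 * wordMat l 0 0 + wordMat l 1 0 := by
  induction l using List.reverseRecOn with
  | nil => simp [wordMat_nil]
  | append_singleton l a ih =>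
    obtain ⟨hl, ha⟩ := binary_append.1 hl
    obtain ⟨e1, e2, e3, e4⟩ := wordMat_concat_entries l a
    have := wordMat_upper_lt hl
    obtain ⟨h1, h2, h3, h4⟩ := wordMat_pos hl
    rw [e1, e2, e3, e4]
    rcases ha a (by simp) with rfl | rfl <;> linarith

theorem wordMat_append_lt {l m : List ℤ} (hl : Binary l) (hm : Binary m) (hne : m ≠ []) :
    wordMat l 0 1 < wordMat (l ++ m) 0 1 := by
  induction m using List.reverseRecOn with
  | nil => simp at hne
  | append_singleton m a ih =>
    obtain ⟨hm, ha⟩ := binary_append.1 hm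
    obtain ⟨e1, e2, e3, e4⟩ := wordMat_concat_entries (l ++ m) a
    obtain ⟨h1, h2, h3, h4⟩ := wordMat_pos (binary_append.2 ⟨hl, hm⟩)
    rw [← List.append_assoc, e2]
    have : wordMat l 0 1 ≤ wordMat (l ++ m) 0 1 := by
      rcases eq_or_ne m [] with rfl | h
      · simp
      · exact (ih hm h).le
    rcases ha a (by simp) with rfl | rfl <;> linarith

/-- A word of the form `1x` has a smaller upper right entry than `0xe`. -/
theorem wordMat_one_cons_lt {x : List ℤ} {e : ℤ} (hx : Binary x) (he : e = 0 ∨ e = 1) :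
    wordMat (1 :: x) 0 1 < wordMat (0 :: (x ++ [e])) 0 1 := by
  have h := wordMat_row_ineq hx
  obtain ⟨h1, h2, h3, h4⟩ := wordMat_pos hx
  obtain ⟨-, e2, -, e4⟩ := wordMat_concat_entries x e
  rw [(wordMat_cons_entries _ _).2.1, (wordMat_cons_entries _ _).2.1, e2, e4]
  rcases he with rfl | rfl <;> linarith

/-- The difference of the two sides is the determinant formed by the first column of `r` and the
second column of `t`. Removing a common first letter preserves it, since letters have determinant 1.
At the first mismatch only 1 in `r` against 0 in `t` is allowed, and there it is visibly positive.
-/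
theorem wordMat_cross_lt {r t : List ℤ} (hr : Binary r) (ht : Binary t)
    (h : ∀ x r' t', r = x ++ 0 :: r' → t = x ++ 1 :: t' → False) :
    wordMat r 1 0 * wordMat t 0 1 < wordMat r 0 0 * wordMat t 1 1 := by
  induction r generalizing t with
  | nil => simpa [wordMat_nil] using (wordMat_pos ht).2.2.2
  | cons a r ih =>
    cases t with
    | nil => simpa [wordMat_nil] using (wordMat_pos hr).1
    | cons b t =>
      obtain ⟨ha, hr⟩ := binary_cons.1 hr
      obtain ⟨hb, ht⟩ := binary_cons.1 ht
      obtain ⟨e1, -, e3, -⟩ := wordMat_cons_entries a r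
      obtain ⟨-, f2, -, f4⟩ := wordMat_cons_entries b t
      rw [e1, e3, f2, f4]
      obtain ⟨h1, -, h3, -⟩ := wordMat_pos hr
      obtain ⟨-, k2, -, k4⟩ := wordMat_pos ht
      have key (hab : a = b) :
          wordMat r 1 0 * wordMat t 0 1 < wordMat r 0 0 * wordMat t 1 1 :=
        ih hr ht fun x r' t' hx hy =>
          h (a :: x) r' t' (by simp [hx]) (by simp [hy, hab])
      rcases ha with rfl | rfl <;> rcases hb with rfl | rfl
      · linarith [key rfl]
      · exact (h [] r t rfl rfl).elim
      · have i1 := mul_pos h1 k4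
        have i2 := mul_nonneg h1.le k2
        have i3 := mul_nonneg h3 k4.le
        linarith
      · linarith [key rfl]

/-- Replacing an occurrence of `01` by `10` increases the upper right entry, unless the word has a
factor `0 y 01 x 1` where `y` is the reversal of `x`. -/
theorem wordMat_swap_lt {p t : List ℤ} (hp : Binary p) (ht : Binary t)
    (h : ∀ x r' t', p.reverse = x ++ 0 :: r' → t = x ++ 1 :: t' → False) :
    wordMat (p ++ 0 :: 1 :: t) 0 1 < wordMat (p ++ 1 :: 0 :: t) 0 1 := by
  have hpr : Binary p.reverse := fun e he => hp e (List.mem_reverse.1 he)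
  -- With A₀, A₁ the letter matrices, A₁A₀ - A₀A₁ = (0 2; -2 0), so the gain is twice the
  -- determinant of `wordMat_cross_lt`.
  have key := wordMat_cross_lt hpr ht h
  rw [wordMat_reverse] at key
  simp only [Matrix.transpose_apply] at key
  simp only [wordMat_append, Matrix.mul_apply, Fin.sum_univ_two, wordMat_cons_entries]
  linarith

/-! ### Words as increments of height functions -/

/-- The list of the `n` increments of `Z` that start at the index `s`. -/
def increments (Z : ℕ → ℤ) : ℕ → ℕ → List ℤ
  | _, 0 => []
  | s, n + 1 => (Z (s + 1) - Z s) :: increments Z (s + 1) n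

theorem increments_add (Z : ℕ → ℤ) (s m n : ℕ) :
    increments Z s (m + n) = increments Z s m ++ increments Z (s + m) n := by
  induction m generalizing s with
  | zero => simp [increments]
  | succ m ih =>
    rw [Nat.succ_add, increments, increments, ih, List.cons_append, Nat.add_right_comm s 1 m,
      Nat.add_assoc s m 1]

theorem length_increments (Z : ℕ → ℤ) (s n : ℕ) : (increments Z s n).length = n := by
  induction n generalizing s with
  | zero => simp [increments]
  | succ n ih => simp [increments, ih]

theorem sum_increments (Z : ℕ → ℤ) (s n : ℕ) : (increments Z s n).sum = Z (s + n) - Z s := by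
  induction n generalizing s with
  | zero => simp [increments]
  | succ n ih =>
    rw [increments, List.sum_cons, ih, Nat.add_right_comm, Nat.add_assoc]
    ring

theorem increments_congr {Y Z : ℕ → ℤ} {s n : ℕ} (h : ∀ i, s ≤ i → i ≤ s + n → Y i = Z i) :
    increments Y s n = increments Z s n := by
  induction n generalizing s with
  | zero => simp [increments]
  | succ n ih =>
    rw [increments, increments, h s le_rfl (by omega), h (s + 1) (by omega) (by omega),
      ih fun i h1 h2 => h i (by omega) (by omega)]

theorem binary_increments {Z : ℕ → ℤ} {s n : ℕ}
    (h : ∀ i, s ≤ i → i < s + n → Z (i + 1) - Z i = 0 ∨ Z (i + 1) - Z i = 1) :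
    Binary (increments Z s n) := by
  induction n generalizing s with
  | zero => simp [increments, Binary]
  | succ n ih =>
    rw [increments, binary_cons]
    exact ⟨h s le_rfl (by omega), ih fun i h1 h2 => h i (by omega) (by omega)⟩

theorem sum_of_prefix_increments {Z : ℕ → ℤ} {s n : ℕ} {x y : List ℤ}
    (h : increments Z s n = x ++ y) : x.length ≤ n ∧ Z (s + x.length) - Z s = x.sum := by
  have hn : n = x.length + y.length := by
    rw [← length_increments Z s n, h, List.length_append]
  rw [hn, increments_add] at h
  have := (List.append_inj h (length_increments _ _ _)).1
  exact ⟨by omega, by rw [← sum_increments, this]⟩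

theorem sum_of_suffix_increments {Z : ℕ → ℤ} {n : ℕ} {x y : List ℤ}
    (h : increments Z 0 n = y ++ x) : x.length ≤ n ∧ Z n - Z (n - x.length) = x.sum := by
  have hn : n = y.length + x.length := by
    rw [← length_increments Z 0 n, h, List.length_append]
  have h' := h
  rw [hn, increments_add] at h'
  have := (List.append_inj h' (length_increments _ _ _)).2
  refine ⟨by omega, ?_⟩
  rw [← this, sum_increments, length_increments, hn]
  simp

/-! ### Height functions along a line of irrational slope -/

/-- On `{0, …, n}` the function `Z` follows a line of slope `α`, with oscillation below `1`. -/
def FollowsSlope (α : ℝ) (n : ℕ) (Z : ℕ → ℤ) : Prop :=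
  ∀ i ≤ n, ∀ j ≤ n, (Z i - Z j : ℝ) < α * (i - j) + 1

namespace FollowsSlope

variable {α : ℝ} {n : ℕ} {U V : ℕ → ℤ}

theorem mono {m : ℕ} (hU : FollowsSlope α n U) (h : m ≤ n) : FollowsSlope α m U :=
  fun i hi j hj => hU i (hi.trans h) j (hj.trans h)

theorem step (hU : FollowsSlope α n U) (h0 : 0 < α) (h1 : α < 1) {i : ℕ} (hi : i < n) :
    U (i + 1) - U i = 0 ∨ U (i + 1) - U i = 1 := by
  have a := hU (i + 1) hi i hi.le
  have b := hU i hi.le (i + 1) hi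
  push_cast at a b
  have a' : ((U (i + 1) - U i : ℤ) : ℝ) < (2 : ℤ) := by push_cast; linarith
  have b' : ((-1 : ℤ) : ℝ) < ((U (i + 1) - U i : ℤ) : ℝ) := by push_cast; linarith
  rw [Int.cast_lt] at a' b'
  omega

theorem binary (hU : FollowsSlope α n U) (h0 : 0 < α) (h1 : α < 1) {s m : ℕ} (h : s + m ≤ n) :
    Binary (increments U s m) :=
  binary_increments fun _ _ h2 => hU.step h0 h1 (h2.trans_le h)

/-- Among the indices where `U < V`, raise `U` at the one that is lowest relative to the line. -/
theorem exists_raise (hα : Irrational α) (hU : FollowsSlope α n U) (hV : FollowsSlope α n V)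
    (hUV : ∀ i ≤ n, U i ≤ V i) (hne : ∃ i ≤ n, U i < V i) :
    ∃ i ≤ n, U i < V i ∧ FollowsSlope α n (Function.update U i (U i + 1)) := by
  classical
  let D := (Finset.range (n + 1)).filter fun i => U i < V i
  have hD : D.Nonempty := by
    obtain ⟨i, hi, h⟩ := hne
    exact ⟨i, by simp only [D, Finset.mem_filter, Finset.mem_range]; exact ⟨by omega, h⟩⟩
  obtain ⟨i, hiD, hmin⟩ := D.exists_min_image (fun i => (U i : ℝ) - α * i) hD
  have hi := hiD
  simp only [D, Finset.mem_filter, Finset.mem_range] at hi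
  refine ⟨i, by omega, hi.2, ?_⟩
  intro j hj k hk
  rcases eq_or_ne j i with rfl | hji
  · rcases eq_or_ne k j with rfl | hkj
    · simp
    · rw [Function.update_self, Function.update_of_ne hkj]
      push_cast
      by_cases hkD : k ∈ D
      · have hle := hmin k hkD
        -- A tie would make α rational; the minimum is therefore strict, which leaves room for the
        -- raise.
        have hne : (U j : ℝ) - α * j ≠ U k - α * k := by
          intro h
          have hd : (j : ℝ) - k ≠ 0 := sub_ne_zero.2 (by exact_mod_cast hkj.symm)
          refine hα ⟨((U j - U k : ℤ) : ℚ) / ((j - k : ℤ) : ℚ), ?_⟩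
          push_cast
          rw [div_eq_iff hd]
          linarith
        have := lt_of_le_of_ne hle hne
        linarith
      -- Here U and V agree at `k`, so the bound for V carries over.
      · have hkV : V k = U k := by
          have := hUV k hk
          simp only [D, Finset.mem_filter, Finset.mem_range, not_and, not_lt] at hkD
          have := hkD (by omega)
          omega
        have h1 := hV j hj k hk
        have h2 : ((U j : ℝ) + 1) ≤ V j := by exact_mod_cast hi.2
        rw [hkV] at h1
        linarith
  · rw [Function.update_of_ne hji]
    rcases eq_or_ne k i with rfl | hki
    · rw [Function.update_self]
      have := hU j hj k hk
      push_cast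
      linarith
    · rw [Function.update_of_ne hki]
      exact hU j hj k hk

/-- Steps are 0 or 1 both before and after the raise, which forces a 0 just before `i` and, if `i <
n`, a 1 just after it. -/
theorem raise_lt (h0 : 0 < α) (h1 : α < 1) {i : ℕ} (hi0 : i ≠ 0) (hin : i ≤ n)
    (hU : FollowsSlope α n U) (hW : FollowsSlope α n (Function.update U i (U i + 1))) :
    wordMat (increments U 0 n) 0 1 <
      wordMat (increments (Function.update U i (U i + 1)) 0 n) 0 1 := by
  obtain ⟨m, rfl⟩ : ∃ m, i = m + 1 := ⟨i - 1, by omega⟩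
  have hb : increments (Function.update U (m + 1) (U (m + 1) + 1)) 0 m = increments U 0 m :=
    increments_congr fun j _ hj => Function.update_of_ne (by omega) _ _
  have hl : U (m + 1) - U m = 0 := by
    have a := hU.step h0 h1 (i := m) (by omega)
    have b := hW.step h0 h1 (i := m) (by omega)
    rw [Function.update_self, Function.update_of_ne (by omega)] at b
    omega
  have hp : Binary (increments U 0 m) := hU.binary h0 h1 (by omega)
  rcases Nat.eq_or_lt_of_le hin with rfl | hlt
  · simp only [increments_add _ 0 m 1, hb]
    simp only [increments, Nat.zero_add, Function.update_self,
      Function.update_of_ne (show m ≠ m + 1 by omega), wordMat_concat_entries]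
    have := (wordMat_pos hp).1
    rw [add_sub_right_comm, hl]
    linarith
  · obtain ⟨k, rfl⟩ : ∃ k, n = m + (k + 2) := ⟨n - m - 2, by omega⟩
    have hc : increments (Function.update U (m + 1) (U (m + 1) + 1)) (m + 2) k =
        increments U (m + 2) k :=
      increments_congr fun j hj _ => Function.update_of_ne (by omega) _ _
    have hr : U (m + 2) - U (m + 1) = 1 := by
      have a := hU.step h0 h1 (i := m + 1) (by omega)
      have b := hW.step h0 h1 (i := m + 1) (by omega)
      rw [Function.update_self, Function.update_of_ne (by omega)] at b
      have e : m + 1 + 1 = m + 2 := rfl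
      rw [e] at a b
      omega
    rw [increments_add _ 0 m (k + 2), increments_add _ 0 m (k + 2), hb]
    simp only [increments, Nat.zero_add, Function.update_self,
      Function.update_of_ne (show m ≠ m + 1 by omega)]
    rw [Function.update_of_ne (show m + 1 + 1 ≠ m + 1 by omega), hc, hl,
      show U (m + 1) + 1 - U m = 1 by omega, show U (m + 1 + 1) - U (m + 1) = 1 from hr,
      show U (m + 1 + 1) - (U (m + 1) + 1) = 0 by
        rw [← sub_sub, show U (m + 1 + 1) - U (m + 1) = 1 from hr]; rfl]
    refine wordMat_swap_lt hp (hU.binary h0 h1 (by omega)) fun x r' t' hx hy => ?_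
    have hx' : increments U 0 m = r'.reverse ++ (0 :: x.reverse) := by
      rw [← List.reverse_reverse (increments U 0 m), hx]
      simp
    have hy' : increments U (m + 2) k = (x ++ [1]) ++ t' := by simp [hy]
    obtain ⟨l1, s1⟩ := sum_of_suffix_increments hx'
    obtain ⟨l2, s2⟩ := sum_of_prefix_increments hy'
    simp only [List.length_cons, List.length_reverse, List.sum_cons, List.sum_reverse,
      List.length_append, List.sum_append, List.length_nil, List.sum_nil] at l1 s1 l2 s2
    -- In the excluded configuration, the blocks 0 x' 0 (x' the reversal of x) and 1 x 1 meet at `m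
    -- + 1`. They have equal length but heights differing by 2, whereas the slope bounds allow less
    -- than 2.
    have b1 := hU (m + 2 + (x.length + (0 + 1))) (by omega) (m + 1) (by omega)
    have b2 := hU (m - (x.length + 1)) (by omega) (m + 1) (by omega)
    rw [Nat.cast_sub l1] at b2
    push_cast at b1 b2
    have e : U (m + 2 + (x.length + (0 + 1))) - U (m + 1) =
        U (m + 1) - U (m - (x.length + 1)) + 2 := by linarith
    have e' : (U (m + 2 + (x.length + (0 + 1))) - U (m + 1) : ℝ) =
        U (m + 1) - U (m - (x.length + 1)) + 2 := by exact_mod_cast e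
    linarith

/-- Iterate `raise_lt`; the total gap between U and V decreases at each raise. -/
theorem wordMat_lt (hα : Irrational α) (h0 : 0 < α) (h1 : α < 1) (hU : FollowsSlope α n U)
    (hV : FollowsSlope α n V) (h00 : U 0 = V 0) (hUV : ∀ i ≤ n, U i ≤ V i)
    (hne : ∃ i ≤ n, U i < V i) :
    wordMat (increments U 0 n) 0 1 < wordMat (increments V 0 n) 0 1 := by
  obtain ⟨d, hd⟩ : ∃ d : ℕ, ∑ i ∈ Finset.range (n + 1), (V i - U i).toNat = d := ⟨_, rfl⟩
  induction d using Nat.strong_induction_on generalizing U with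
  | _ d ih =>
  obtain ⟨i, hi, hlt, hW⟩ := exists_raise hα hU hV hUV hne
  have hi0 : i ≠ 0 := by rintro rfl; omega
  have hstep := raise_lt h0 h1 hi0 hi hU hW
  have hWV : ∀ j ≤ n, Function.update U i (U i + 1) j ≤ V j := by
    intro j hj
    rcases eq_or_ne j i with rfl | hji
    · rw [Function.update_self]; omega
    · rw [Function.update_of_ne hji]; exact hUV j hj
  by_cases hne' : ∃ j ≤ n, Function.update U i (U i + 1) j < V j
  · refine hstep.trans (ih _ ?_ hW ?_ hWV hne' rfl)
    · rw [← hd]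
      refine Finset.sum_lt_sum (fun j _ => ?_) ⟨i, Finset.mem_range.2 (by omega), ?_⟩
      · rcases eq_or_ne j i with rfl | hji
        · rw [Function.update_self]; omega
        · rw [Function.update_of_ne hji]
      · rw [Function.update_self]; omega
    · rw [Function.update_of_ne hi0.symm, h00]
  · push Not at hne'
    rwa [increments_congr (Y := Function.update U i (U i + 1)) (Z := V)
      fun j _ hj => le_antisymm (hWV j (by omega)) (hne' j (by omega))] at hstep

theorem wordMat_le (hα : Irrational α) (h0 : 0 < α) (h1 : α < 1) (hU : FollowsSlope α n U)
    (hV : FollowsSlope α n V) (h00 : U 0 = V 0) (hUV : ∀ i ≤ n, U i ≤ V i) :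
    wordMat (increments U 0 n) 0 1 ≤ wordMat (increments V 0 n) 0 1 := by
  by_cases hne : ∃ i ≤ n, U i < V i
  · exact (wordMat_lt hα h0 h1 hU hV h00 hUV hne).le
  · push Not at hne
    rw [increments_congr fun j _ hj => le_antisymm (hUV j (by omega)) (hne j (by omega))]

theorem wordMat_lt_succ (hα : Irrational α) (h0 : 0 < α) (h1 : α < 1) (hU : FollowsSlope α n U)
    (hV : FollowsSlope α (n + 1) V) (hU0 : U 0 = 0) (hV0 : V 0 = 0) :
    wordMat (increments U 0 n) 0 1 < wordMat (increments V 0 (n + 1)) 0 1 := by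
  cases n with
  | zero =>
    have := wordMat_append_lt (l := []) (by simp [Binary]) (hV.binary h0 h1 le_rfl)
      (by simp [increments])
    simpa [increments] using this
  | succ n =>
    let C : ℕ → ℤ := fun i => ⌈α * i⌉
    let F : ℕ → ℤ := fun i => ⌊α * i⌋
    have hC : FollowsSlope α (n + 1) C := fun i _ j _ => by
      have a := Int.ceil_lt_add_one (α * i)
      have b := Int.le_ceil (α * j)
      simp only [C]
      linarith
    have hF : FollowsSlope α (n + 1 + 1) F := fun i _ j _ => by
      have a := Int.floor_le (α * i)
      have b := Int.lt_floor_add_one (α * j)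
      simp only [F]
      linarith
    have hUC : ∀ i ≤ n + 1, U i ≤ C i := fun i hi => by
      have a := hU i hi 0 (by omega)
      have b := Int.le_ceil (α * i)
      rw [hU0] at a
      push_cast at a
      have : (U i : ℝ) < ((C i + 1 : ℤ) : ℝ) := by push_cast; simp only [C]; linarith
      rw [Int.cast_lt] at this
      omega
    have hFV : ∀ i ≤ n + 1 + 1, F i ≤ V i := fun i hi => by
      have a := hV 0 (by omega) i hi
      have b := Int.floor_le (α * i)
      rw [hV0] at a
      push_cast at a
      have : (F i : ℝ) < ((V i + 1 : ℤ) : ℝ) := by push_cast; simp only [F]; linarith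
      rw [Int.cast_lt] at this
      omega
    have hCF : ∀ i : ℕ, 1 ≤ i → C i = F i + 1 := fun i hi => by
      have hirr : Irrational (α * i) := hα.mul_natCast (by omega)
      have a : (⌊α * i⌋ : ℝ) ≠ α * i := fun h => hirr ⟨⌊α * i⌋, by push_cast; exact h⟩
      have b := lt_of_le_of_ne (Int.floor_le (α * i)) a
      simp only [C, F]
      rw [Int.ceil_eq_iff]
      push_cast
      exact ⟨by linarith, (Int.lt_floor_add_one _).le⟩
    have hF0 : F 0 = 0 := by simp [F]
    have hC0 : C 0 = 0 := by simp [C]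
    have hF1 : F 1 = 0 := by
      simp only [F, Nat.cast_one, mul_one]
      exact Int.floor_eq_zero_iff.2 ⟨h0.le, h1⟩
    have hC1 : C 1 = 1 := by rw [hCF 1 le_rfl, hF1]; rfl
    have hx : increments C 1 n = increments F 1 n := by
      have h : ∀ (k s : ℕ), 1 ≤ s → increments C s k = increments F s k := by
        intro k
        induction k with
        | zero => simp [increments]
        | succ k ih =>
          intro s hs
          rw [increments, increments, hCF s hs, hCF (s + 1) (by omega), ih _ (by omega)]
          simp
      exact h n 1 le_rfl
    refine (wordMat_le hα h0 h1 hU hC (by rw [hU0, hC0]) hUC).trans_lt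
      (lt_of_lt_of_le ?_ (wordMat_le hα h0 h1 hF hV (by rw [hF0, hV0]) hFV))
    have e1 : increments C 0 (n + 1) = 1 :: increments F 1 n := by
      rw [increments, Nat.zero_add, hx, hC1, hC0]; rfl
    have e2 : increments F 0 (n + 1 + 1) = 0 :: (increments F 1 n ++ [F (n + 2) - F (n + 1)]) := by
      rw [increments, Nat.zero_add, increments_add, hF1, hF0]
      simp only [increments, Nat.add_comm 1 n]
      rfl
    rw [e1, e2]
    exact wordMat_one_cons_lt (hF.binary h0 h1 (by omega)) (hF.step h0 h1 (by omega))

theorem wordMat_lt_of_length_lt {m : ℕ} (hα : Irrational α) (h0 : 0 < α) (h1 : α < 1)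
    (hU : FollowsSlope α n U) (hV : FollowsSlope α m V) (hU0 : U 0 = 0) (hV0 : V 0 = 0)
    (hnm : n < m) : wordMat (increments U 0 n) 0 1 < wordMat (increments V 0 m) 0 1 := by
  have h := wordMat_lt_succ hα h0 h1 hU (hV.mono hnm) hU0 hV0
  obtain ⟨k, rfl⟩ := Nat.exists_eq_add_of_le (Nat.succ_le_of_lt hnm)
  rw [Nat.succ_eq_add_one, increments_add _ 0 (n + 1) k]
  rcases eq_or_ne (increments V (0 + (n + 1)) k) [] with e | e
  · rwa [e, List.append_nil]
  · exact h.trans (wordMat_append_lt (hV.binary h0 h1 (by omega)) (hV.binary h0 h1 (by omega)) e)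

end FollowsSlope

/-! ### Balanced sequences and their slopes -/

/-- The number of letters `1` among the `n` letters of `s` that start at the index `k`. -/
def height (s : ℤ → Fin 2) (k : ℤ) (n : ℕ) : ℤ := ∑ j ∈ Finset.range n, ((s (k + j) : ℕ) : ℤ)

theorem height_zero (s : ℤ → Fin 2) (k : ℤ) : height s k 0 = 0 := by simp [height]

theorem height_succ (s : ℤ → Fin 2) (k : ℤ) (n : ℕ) :
    height s k (n + 1) = height s k n + ((s (k + n) : ℕ) : ℤ) := by
  simp [height, Finset.sum_range_succ]

theorem height_add (s : ℤ → Fin 2) (k : ℤ) (m n : ℕ) :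
    height s k (m + n) = height s k m + height s (k + m) n := by
  simp [height, Finset.sum_range_add, add_assoc]

theorem height_nonneg (s : ℤ → Fin 2) (k : ℤ) (n : ℕ) : 0 ≤ height s k n :=
  Finset.sum_nonneg fun _ _ => by positivity

theorem height_le (s : ℤ → Fin 2) (k : ℤ) (n : ℕ) : height s k n ≤ n := by
  induction n with
  | zero => simp [height_zero]
  | succ n ih =>
    rw [height_succ]
    have := (s (k + n)).isLt
    omega

theorem count_ofFn_eq_height (s : ℤ → Fin 2) (k : ℤ) (n : ℕ) :
    (((List.ofFn fun i : Fin n => s (k + (i : ℕ))).count 1 : ℕ) : ℤ) = height s k n := by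
  induction n with
  | zero => simp [height_zero]
  | succ n ih =>
    rw [List.ofFn_succ', height_succ, List.concat_eq_append, List.count_append]
    simp only [Fin.val_castSucc, Fin.val_last]
    push_cast
    rw [ih]
    generalize s (k + n) = a
    fin_cases a <;> simp

theorem map_ofFn_eq_increments (s : ℤ → Fin 2) (k : ℤ) (n : ℕ) :
    (List.ofFn fun i : Fin n => s (k + (i : ℕ))).map (fun a : Fin 2 => ((a : ℕ) : ℤ)) =
      increments (height s k) 0 n := by
  induction n with
  | zero => simp [increments]
  | succ n ih =>
    rw [List.ofFn_succ', List.concat_eq_append, List.map_append, increments_add]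
    simp only [Fin.val_castSucc, Fin.val_last]
    rw [ih]
    simp [increments, height_succ]

theorem IsBalanced.height_sub_le {s : ℤ → Fin 2} (hs : IsBalanced s) (k l : ℤ) (n : ℕ) :
    height s k n - height s l n ≤ 1 := by
  rcases Nat.eq_zero_or_pos n with rfl | hn
  · simp [height_zero]
  · have h := hs n hn _ ⟨k, n, rfl⟩ _ ⟨l, n, rfl⟩ (by simp) (by simp) 1
    simp only [FreeMonoid.toList_ofList, count_ofFn_eq_height] at h
    exact (abs_le.1 h).2

/-- Equivalently, each lower bound (h - 1)/n on the slope is below each upper bound (h' + 1)/m. The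
proof is a subtractive Euclidean algorithm: cut from the longer factor a block as long as the
shorter one and compare these two by balance. -/
theorem IsBalanced.mul_height_lt {s : ℤ → Fin 2} (hs : IsBalanced s) :
    ∀ (n m : ℕ) (k l : ℤ), 0 < n → 0 < m →
      (m : ℤ) * height s k n - n * height s l m < n + m := by
  intro n m
  obtain ⟨d, hd⟩ : ∃ d, n + m = d := ⟨_, rfl⟩
  induction d using Nat.strong_induction_on generalizing n m with
  | _ d ih =>
  intro k l hn hm
  rcases lt_trichotomy n m with h | rfl | h
  · obtain ⟨c, rfl⟩ := Nat.exists_eq_add_of_lt h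
    have h1 := ih (n + (c + 1)) (by omega) n (c + 1) rfl k (l + n) hn (by omega)
    have h2 := mul_le_mul_of_nonneg_left (hs.height_sub_le k l n) (Int.natCast_nonneg n)
    rw [add_assoc n c 1, height_add s l n (c + 1)]
    push_cast at h1 h2 ⊢
    linarith
  · have h2 := mul_le_mul_of_nonneg_left (hs.height_sub_le k l n) (Int.natCast_nonneg n)
    have : (0 : ℤ) < n := by exact_mod_cast hn
    linarith
  · obtain ⟨c, rfl⟩ := Nat.exists_eq_add_of_lt h
    have h1 := ih (m + (c + 1)) (by omega) (c + 1) m (by omega) (k + m) l (by omega) hm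
    have h2 := mul_le_mul_of_nonneg_left (hs.height_sub_le k l m) (Int.natCast_nonneg m)
    rw [add_assoc m c 1, height_add s k m (c + 1)]
    push_cast at h1 h2 ⊢
    linarith

/-- All factors of length at most `N` of a balanced sequence follow a common irrational slope. -/
theorem IsBalanced.exists_slope {s : ℤ → Fin 2} (hs : IsBalanced s) (N : ℕ) :
    ∃ α : ℝ, Irrational α ∧ 0 < α ∧ α < 1 ∧ ∀ k, FollowsSlope α N (height s k) := by
  classical
  -- Only finitely many pairs (height, length) occur up to length `N`, so the strict bounds leave an
  -- open interval for α. Without the cutoff, α would have to be the frequency of 1, possibly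
  -- rational.
  let I := (Finset.Icc 0 (N : ℤ) ×ˢ Finset.Icc 1 N).filter fun p => ∃ k, height s k p.2 = p.1
  let lo : Finset ℝ := insert 0 (I.image fun p => ((p.1 : ℝ) - 1) / p.2)
  let hi : Finset ℝ := insert 1 (I.image fun p => ((p.1 : ℝ) + 1) / p.2)
  have hI : ∀ k n, 0 < n → n ≤ N → (height s k n, n) ∈ I := fun k n h1 h2 => by
    simp only [I, Finset.mem_filter, Finset.mem_product, Finset.mem_Icc]
    have := height_le s k n
    exact ⟨⟨⟨height_nonneg s k n, by omega⟩, h1, h2⟩, k, rfl⟩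
  have hI' : ∀ a n, (a, n) ∈ I → 0 < n ∧ ∃ k, height s k n = a := fun a n hp => by
    simp only [I, Finset.mem_filter, Finset.mem_product, Finset.mem_Icc] at hp
    exact ⟨hp.1.2.1, hp.2⟩
  have hlt : ∀ x ∈ lo, ∀ y ∈ hi, x < y := by
    intro x hx y hy
    simp only [lo, hi, Finset.mem_insert, Finset.mem_image] at hx hy
    rcases hx with rfl | ⟨⟨a, n⟩, hp, rfl⟩ <;> rcases hy with rfl | ⟨⟨b, m⟩, hp', rfl⟩
    · norm_num
    · obtain ⟨hm, l, rfl⟩ := hI' _ _ hp'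
      have : (0 : ℝ) < m := by exact_mod_cast hm
      have : (0 : ℝ) ≤ height s l m := by exact_mod_cast height_nonneg s l m
      positivity
    · obtain ⟨hn, k, rfl⟩ := hI' _ _ hp
      have h1 : (0 : ℝ) < n := by exact_mod_cast hn
      have h2 : (height s k n : ℝ) ≤ n := by exact_mod_cast height_le s k n
      rw [div_lt_one h1]
      simp only
      linarith
    · obtain ⟨hn, k, rfl⟩ := hI' _ _ hp
      obtain ⟨hm, l, rfl⟩ := hI' _ _ hp'
      have h1 : (0 : ℝ) < n := by exact_mod_cast hn
      have h2 : (0 : ℝ) < m := by exact_mod_cast hm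
      have h3 : (m : ℝ) * height s k n - n * height s l m < n + m := by
        exact_mod_cast hs.mul_height_lt n m k l hn hm
      rw [div_lt_div_iff₀ h1 h2]
      simp only
      linarith
  obtain ⟨x, hx1, hx2⟩ := Order.exists_between_finsets lo hi hlt
  obtain ⟨y, hy1, hy2⟩ := Order.exists_between_finsets {x} hi (by simpa using hx2)
  obtain ⟨α, hα, hxα, hαy⟩ := exists_irrational_btwn (hy1 x (by simp))
  have hlo : ∀ z ∈ lo, z < α := fun z hz => (hx1 z hz).trans hxα
  have hhi : ∀ z ∈ hi, α < z := fun z hz => hαy.trans (hy2 z hz)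
  refine ⟨α, hα, hlo 0 (by simp [lo]), hhi 1 (by simp [hi]), fun k i hi' j hj' => ?_⟩
  rcases lt_trichotomy i j with h | rfl | h
  · obtain ⟨c, rfl⟩ := Nat.exists_eq_add_of_lt h
    rw [add_assoc, height_add s k i (c + 1)]
    have hc : (0 : ℝ) < (c + 1 : ℕ) := by positivity
    have := hhi _ (Finset.mem_insert_of_mem (Finset.mem_image_of_mem _
      (hI (k + i) (c + 1) (by omega) (by omega))))
    rw [lt_div_iff₀ hc] at this
    push_cast at this ⊢
    linarith
  · simp
  · obtain ⟨c, rfl⟩ := Nat.exists_eq_add_of_lt h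
    rw [add_assoc, height_add s k j (c + 1)]
    have hc : (0 : ℝ) < (c + 1 : ℕ) := by positivity
    have := hlo _ (Finset.mem_insert_of_mem (Finset.mem_image_of_mem _
      (hI (k + j) (c + 1) (by omega) (by omega))))
    rw [div_lt_iff₀ hc] at this
    push_cast at this ⊢
    linarith

/-- If the heights differ, equal entries force each to exceed the other somewhere; between two such
indices the factors would differ in height by at least 2, against balance. -/
theorem IsBalanced.eq_of_wordMat_eq {s : ℤ → Fin 2} (hs : IsBalanced s) {k l : ℤ} {n m : ℕ}
    (h : wordMat (increments (height s k) 0 n) 0 1 = wordMat (increments (height s l) 0 m) 0 1) :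
    n = m ∧ increments (height s k) 0 n = increments (height s l) 0 m := by
  obtain ⟨α, hα, h0, h1, hS⟩ := hs.exists_slope (max n m)
  have hn (k : ℤ) : FollowsSlope α n (height s k) := (hS k).mono (le_max_left n m)
  have hm (k : ℤ) : FollowsSlope α m (height s k) := (hS k).mono (le_max_right n m)
  rcases lt_trichotomy n m with hnm | rfl | hnm
  · exact absurd h ((hn k).wordMat_lt_of_length_lt hα h0 h1 (hm l) (height_zero s k)
      (height_zero s l) hnm).ne
  · refine ⟨rfl, ?_⟩
    have key : ∀ k l : ℤ,
        wordMat (increments (height s k) 0 n) 0 1 = wordMat (increments (height s l) 0 n) 0 1 →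
        (∃ i ≤ n, height s k i < height s l i) → ∃ j ≤ n, height s l j < height s k j := by
      intro k l h hne
      by_contra! hle
      exact ((hn k).wordMat_lt hα h0 h1 (hn l) (by simp [height_zero]) hle hne).ne h
    have hanti : ∀ i ≤ n, ¬ height s k i < height s l i := by
      intro i hi hlt
      obtain ⟨j, hj, hlt'⟩ := key k l h ⟨i, hi, hlt⟩
      rcases lt_trichotomy i j with hij | rfl | hij
      · obtain ⟨c, rfl⟩ := Nat.exists_eq_add_of_lt hij
        rw [add_assoc, height_add s l i (c + 1), height_add s k i (c + 1)] at hlt'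
        have := hs.height_sub_le (k + i) (l + i) (c + 1)
        omega
      · omega
      · obtain ⟨c, rfl⟩ := Nat.exists_eq_add_of_lt hij
        rw [add_assoc, height_add s l j (c + 1), height_add s k j (c + 1)] at hlt
        have := hs.height_sub_le (l + j) (k + j) (c + 1)
        omega
    refine increments_congr fun i _ hi => ?_
    by_contra hne
    rcases lt_or_gt_of_ne hne with hlt | hlt
    · exact hanti i (by omega) hlt
    · obtain ⟨j, hj, hlt'⟩ := key l k h.symm ⟨i, by omega, hlt⟩
      exact hanti j hj hlt'
  · exact absurd h ((hm l).wordMat_lt_of_length_lt hα h0 h1 (hn k) (height_zero s l)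
      (height_zero s k) hnm).ne'

/-! ### Specialization at q = 1 -/

/-- The evaluation of Laurent polynomials at `q = 1`. -/
noncomputable def evalOne : ℤ[T;T⁻¹] →+* ℤ := LaurentPolynomial.eval₂ (RingHom.id ℤ) 1

theorem evalOne_q : evalOne q = 1 := by
  rw [evalOne, q, LaurentPolynomial.eval₂_T]
  simp

theorem map_muq (u : FreeMonoid (Fin 2)) :
    (muq u : Matrix (Fin 2) (Fin 2) ℤ[T;T⁻¹]).map evalOne =
      wordMat ((FreeMonoid.toList u).map fun a : Fin 2 => ((a : ℕ) : ℤ)) := by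
  induction u using FreeMonoid.inductionOn' with
  | one => simp [wordMat_nil]
  | of_mul a u ih =>
    rw [map_mul, Units.val_mul, Matrix.map_mul, ih, FreeMonoid.toList_of_mul, List.map_cons,
      wordMat_cons]
    congr 1
    ext i j
    fin_cases a
    · simp only [Fin.zero_eta, muq_zero]
      fin_cases i <;> fin_cases j <;> simp [letterMat, evalOne_q]
    · have h2 : evalOne 2 = 2 := map_ofNat evalOne 2
      simp only [Fin.mk_one, muq_one]
      fin_cases i <;> fin_cases j <;> simp [letterMat, evalOne_q, h2]

end QMarkoff

/-- For every balanced biinfinite sequence `s` over `{0, 1}`, the map `u ↦ μ_q(u)₁₂` is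
injective on the language of `s`. -/
theorem mainTheorem2 (s : ℤ → Fin 2) (hs : QMarkoff.IsBalanced s) :
    Set.InjOn
      (fun u : FreeMonoid (Fin 2) => (QMarkoff.muq u : Matrix (Fin 2) (Fin 2) ℤ[T;T⁻¹]) 0 1)
      (QMarkoff.language s) := by
  rintro _ ⟨k, n, rfl⟩ _ ⟨l, m, rfl⟩ h
  have h' := congrArg QMarkoff.evalOne h
  simp only [← Matrix.map_apply (f := QMarkoff.evalOne), QMarkoff.map_muq,
    FreeMonoid.toList_ofList, QMarkoff.map_ofFn_eq_increments] at h'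
  have hu := (hs.eq_of_wordMat_eq h').2
  rw [← QMarkoff.map_ofFn_eq_increments, ← QMarkoff.map_ofFn_eq_increments] at hu
  congr 1
  refine List.map_injective_iff.2 (fun a b hab => ?_) hu
  exact Fin.ext (by exact_mod_cast hab)
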